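/- Let $G$ be a compact abelian group, let $\Gamma$ be its (discrete) dual group, i.e. the group of continuous homomorphisms $\gamma\colon G\to\mathbb T=\{z\in\mathbb C:|z|=1\}$, and let $E\subset\Gamma$. Call $E$ independent if, whenever $\gamma_1,\dots,\gamma_k\in E$ are distinct, $m_1,\dots,m_k\in\mathbb Z$ and $\prod_{i=1}^k\gamma_i^{m_i}=1$, then $\gamma_i^{m_i}=1$ for all $i$. (The trivial character is allowed to belong to $E$.) (a) The following are equivalent: (1) for every $\varphi\colon E\to\mathbb T$ with $\varphi(\gamma)\in\gamma(G)$ for all $\gamma\in E$ there exists $x\in G$ such that $\varphi(\gamma)=\gamma(x)$ for all $\gamma\in E$; (2) $E$ is independent. (b) Let $N\ge 1$ be an integer and let $\mathbb Z_N=\{z\in\mathbb T: z^N=1\}$. If $E$ is independent and $\mathbb Z_N\subset\gamma(G)$ for all $\gamma\in E$, then $E$ is $N$-PR ($N$-pseudo-Rademacher), i.e. for every $\varphi\colon E\to\mathbb Z_N$ there exists $x\in G$ such that $\varphi(\gamma)=\gamma(x)$ for all $\gamma\in E$. -/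

import Mathlib

/-- Algebraic independence of a subset `E` of an abelian group (written multiplicatively):
whenever `γ₁, …, γₖ ∈ E` are distinct and `∏ γᵢ ^ mᵢ = 1` with integers `mᵢ`,
then `γᵢ ^ mᵢ = 1` for every `i`. -/
def IsIndependentSet {A : Type*} [CommGroup A] (E : Set A) : Prop :=
  ∀ (s : Finset A), (s : Set A) ⊆ E → ∀ m : A → ℤ,
    ∏ γ ∈ s, γ ^ m γ = 1 → ∀ γ ∈ s, γ ^ m γ = 1

/-- `ℤ_N` as a subset of the circle group: the `N`-th roots of unity. -/
def circleRoots (N : ℕ) : Set Circle := {z | z ^ N = 1}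

/-- A set `E` of continuous characters of `G` is `N`-pseudo-Rademacher if every `ℤ_N`-valued
function on `E` is evaluation at some point of `G`. -/
def IsPseudoRademacher {G : Type*} [CommGroup G] [TopologicalSpace G]
    (N : ℕ) (E : Set (PontryaginDual G)) : Prop :=
  ∀ φ : E → Circle, (∀ γ : E, φ γ ∈ circleRoots N) →
    ∃ x : G, ∀ γ : E, φ γ = (γ : PontryaginDual G) x

/-! The characters map `G` onto a compact subgroup `H` of a product of circles. If `φ` satisfies
every relation among them, Haar measure pushed to `H` and its translate by `φ⁻¹` integrate all
Laurent monomials equally, hence by Stone–Weierstrass all continuous functions. If `φ ∉ H`, the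
cosets `H` and `φ⁻¹H` are disjoint, and a Urysohn function gives a contradiction. Independence
reduces each relation to single-character ones, which pointwise attainable values satisfy.
Conversely, a function equal to 1 off one character isolates its factor in a relation. -/

theorem PontryaginDual.apply_mul {G : Type*} [CommGroup G] [TopologicalSpace G]
    (γ : PontryaginDual G) (a b : G) : γ (a * b) = γ a * γ b :=
  _root_.map_mul γ a b

theorem PontryaginDual.apply_inv {G : Type*} [CommGroup G] [TopologicalSpace G]
    (γ : PontryaginDual G) (a : G) : γ a⁻¹ = (γ a)⁻¹ :=
  map_inv γ a

/-- Evaluation of characters at a point, as a homomorphism. -/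
noncomputable def PontryaginDual.evalHom {G : Type*} [CommGroup G] [TopologicalSpace G] (x : G) :
    PontryaginDual G →* Circle where
  toFun γ := γ x
  map_one' := rfl
  map_mul' _ _ := rfl

open MeasureTheory in
/-- The Haar integral of a nontrivial continuous character of a compact group vanishes. -/
theorem PontryaginDual.integral_eq_zero {G : Type*} [CommGroup G] [TopologicalSpace G]
    [MeasurableSpace G] [MeasurableMul G] (μ : Measure G) [μ.IsMulLeftInvariant]
    {γ : PontryaginDual G} (hγ : γ ≠ 1) : ∫ g, (γ g : ℂ) ∂μ = 0 := by
  obtain ⟨a, ha⟩ : ∃ a, γ a ≠ 1 := by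
    by_contra! h
    exact hγ (PontryaginDual.ext h)
  -- Translating by `a` multiplies the integral by `γ a ≠ 1`.
  have h := integral_mul_left_eq_self (μ := μ) (fun g => (γ g : ℂ)) a
  simp only [PontryaginDual.apply_mul, Circle.coe_mul, integral_const_mul] at h
  by_contra h0
  exact ha (Circle.ext (by simpa using mul_right_cancel₀ h0 (h.trans (one_mul _).symm)))

/-- The Laurent monomial with exponent vector `m` on a product of circles. -/
noncomputable def circleMonomial {ι : Type*} (m : ι →₀ ℤ) : C(ι → Circle, ℂ) where
  toFun z := ((m.prod fun i n => z i ^ n : Circle) : ℂ)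
  continuous_toFun := by
    unfold Finsupp.prod
    fun_prop

theorem circleMonomial_apply {ι : Type*} (m : ι →₀ ℤ) (z : ι → Circle) :
    circleMonomial m z = ((m.prod fun i n => z i ^ n : Circle) : ℂ) := rfl

theorem circleMonomial_apply_mul {ι : Type*} (m : ι →₀ ℤ) (z w : ι → Circle) :
    circleMonomial m (z * w) = circleMonomial m z * circleMonomial m w := by
  simp only [circleMonomial_apply, ← Circle.coe_mul, ← Finsupp.prod_mul, Pi.mul_apply, mul_zpow]

theorem circleMonomial_zero {ι : Type*} : circleMonomial (0 : ι →₀ ℤ) = 1 := by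
  ext z
  simp [circleMonomial_apply]

theorem circleMonomial_add {ι : Type*} (m n : ι →₀ ℤ) :
    circleMonomial (m + n) = circleMonomial m * circleMonomial n := by
  classical
  ext z
  simp only [circleMonomial_apply, ContinuousMap.mul_apply, ← Circle.coe_mul]
  rw [Finsupp.prod_add_index' (by simp) (fun _ _ _ => zpow_add _ _ _)]

theorem star_circleMonomial {ι : Type*} (m : ι →₀ ℤ) :
    star (circleMonomial m) = circleMonomial (-m) := by
  ext z
  simp only [circleMonomial_apply, ContinuousMap.star_apply]
  rw [Finsupp.prod_neg_index (by simp)]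
  simp [← Circle.coe_inv_eq_conj, Finsupp.prod]

/-- Laurent monomials span a dense subspace of the continuous functions on a product of circles. -/
theorem span_circleMonomial_topologicalClosure (ι : Type*) :
    (Submodule.span ℂ (Set.range (circleMonomial (ι := ι)))).topologicalClosure = ⊤ := by
  let M : Submonoid C(ι → Circle, ℂ) :=
    { carrier := Set.range circleMonomial
      one_mem' := ⟨0, circleMonomial_zero⟩
      mul_mem' := by
        rintro _ _ ⟨m, rfl⟩ ⟨n, rfl⟩
        exact ⟨m + n, circleMonomial_add m n⟩ }
  let A : StarSubalgebra ℂ C(ι → Circle, ℂ) :=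
    { Algebra.adjoin ℂ (M : Set C(ι → Circle, ℂ)) with
      star_mem' := by
        intro f hf
        change star f ∈ Algebra.adjoin ℂ (M : Set C(ι → Circle, ℂ))
        refine Algebra.adjoin_induction (p := fun f _ => star f ∈ Algebra.adjoin ℂ
          (M : Set C(ι → Circle, ℂ))) ?_ ?_ ?_ ?_ hf
        · rintro _ ⟨m, rfl⟩
          exact Algebra.subset_adjoin ⟨-m, (star_circleMonomial m).symm⟩
        · intro r
          rw [← algebraMap_star_comm]
          exact Subalgebra.algebraMap_mem _ _
        · intro x y _ _ hx hy
          rw [star_add]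
          exact add_mem hx hy
        · intro x y _ _ hx hy
          rw [star_mul']
          exact mul_mem hx hy }
  have hA : A.SeparatesPoints := by
    intro z w hzw
    obtain ⟨i, hi⟩ := Function.ne_iff.mp hzw
    refine ⟨_, ⟨circleMonomial (Finsupp.single i 1), Algebra.subset_adjoin ⟨_, rfl⟩, rfl⟩, ?_⟩
    simpa [circleMonomial_apply, Circle.ext_iff] using hi
  have hAspan : (A : Set C(ι → Circle, ℂ)) =
      (Submodule.span ℂ (Set.range (circleMonomial (ι := ι))) : Set C(ι → Circle, ℂ)) := by
    change ((Subalgebra.toSubmodule (Algebra.adjoin ℂ (M : Set C(ι → Circle, ℂ))) :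
      Submodule ℂ C(ι → Circle, ℂ)) : Set C(ι → Circle, ℂ)) = _
    rw [Algebra.adjoin_eq_span, Submonoid.closure_eq]
    rfl
  have htop := ContinuousMap.starSubalgebra_topologicalClosure_eq_top_of_separatesPoints A hA
  refine SetLike.coe_injective ?_
  rw [Submodule.topologicalClosure_coe, ← hAspan, ← StarSubalgebra.topologicalClosure_coe, htop]
  rfl

open MeasureTheory in
/-- If a point `φ` of a product of circles satisfies every multiplicative relation satisfied by a
family of continuous characters of a compact group, then `φ` is a value of this family. -/
theorem PontryaginDual.exists_forall_eq_apply {G ι : Type*} [CommGroup G] [TopologicalSpace G]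
    [IsTopologicalGroup G] [CompactSpace G] (γ : ι → PontryaginDual G) (φ : ι → Circle)
    (h : ∀ m : ι →₀ ℤ, (m.prod fun i n => γ i ^ n) = 1 → (m.prod fun i n => φ i ^ n) = 1) :
    ∃ x : G, ∀ i, φ i = γ i x := by
  borelize G
  let μ : Measure G := Measure.haar
  let Φ : G → ι → Circle := fun g i => γ i g
  have hΦ : Continuous Φ := continuous_pi fun i => map_continuous (γ i)
  have hint (f : C(ι → Circle, ℂ)) (c : ι → Circle) : Integrable (fun g => f (c * Φ g)) μ :=
    (by fun_prop : Continuous fun g => f (c * Φ g)).integrable_of_hasCompactSupport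
      (HasCompactSupport.of_compactSpace _)
  have hcont (c : ι → Circle) :
      Continuous fun f : C(ι → Circle, ℂ) => ∫ g, f (c * Φ g) ∂μ := by
    -- The Lipschitz constant is the total mass, finite because `G` is compact.
    refine (LipschitzWith.of_dist_le_mul (K := (μ Set.univ).toNNReal) fun f₁ f₂ => ?_).continuous
    rw [dist_eq_norm, ← integral_sub (hint _ _) (hint _ _), mul_comm]
    refine norm_integral_le_of_norm_le_const (.of_forall fun g => ?_)
    rw [← dist_eq_norm]
    exact ContinuousMap.dist_apply_le_dist _
  have hmon (m : ι →₀ ℤ) :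
      ∫ g, circleMonomial m (φ⁻¹ * Φ g) ∂μ = ∫ g, circleMonomial m (1 * Φ g) ∂μ := by
    let ψ : PontryaginDual G := m.prod fun i n => γ i ^ n
    have hψ (g : G) : circleMonomial m (Φ g) = (ψ g : ℂ) := by
      rw [circleMonomial_apply]
      refine congrArg _ (Eq.trans ?_
        (map_finsuppProd (PontryaginDual.evalHom g) m fun i n => γ i ^ n).symm)
      exact Finset.prod_congr rfl fun i _ => (map_zpow (PontryaginDual.evalHom g) (γ i) (m i)).symm
    simp only [circleMonomial_apply_mul, hψ, integral_const_mul]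
    -- If `ψ = 1`, then `h` makes the factor at `φ⁻¹` equal to 1; otherwise both sides vanish.
    by_cases h1 : ψ = 1
    · have : (m.prod fun i n => φ⁻¹ i ^ n) = 1 := by
        simpa [Finsupp.prod] using h m h1
      rw [circleMonomial_apply, this]
      simp [circleMonomial_apply, Finsupp.prod]
    · simp [PontryaginDual.integral_eq_zero μ h1]
  have hall (f : C(ι → Circle, ℂ)) : ∫ g, f (φ⁻¹ * Φ g) ∂μ = ∫ g, f (1 * Φ g) ∂μ := by
    have hf : f ∈ (Submodule.span ℂ (Set.range (circleMonomial (ι := ι)))).topologicalClosure := by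
      rw [span_circleMonomial_topologicalClosure]
      trivial
    refine closure_minimal (t := {f : C(ι → Circle, ℂ) |
      ∫ g, f (φ⁻¹ * Φ g) ∂μ = ∫ g, f (1 * Φ g) ∂μ}) (fun f hf => ?_)
      (isClosed_eq (hcont _) (hcont _)) hf
    induction hf using Submodule.span_induction with
    | mem f hf =>
      obtain ⟨m, rfl⟩ := hf
      exact hmon m
    | zero => simp
    | add f₁ f₂ _ _ h₁ h₂ =>
      simp only [Set.mem_ofPred_eq, ContinuousMap.add_apply] at h₁ h₂ ⊢
      rw [integral_add (hint _ _) (hint _ _), integral_add (hint _ _) (hint _ _), h₁, h₂]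
    | smul a f _ hf =>
      simp only [Set.mem_ofPred_eq, ContinuousMap.smul_apply, integral_smul] at hf ⊢
      rw [hf]
  by_contra! hne
  have hK : IsCompact (Set.range Φ) := isCompact_range hΦ
  have hK' : IsCompact (Set.range fun g => φ⁻¹ * Φ g) := isCompact_range (by fun_prop)
  have hdisj : Disjoint (Set.range Φ) (Set.range fun g => φ⁻¹ * Φ g) := by
    rw [Set.disjoint_left]
    rintro _ ⟨a, rfl⟩ ⟨b, hb⟩
    -- A common point `Φ a = φ⁻¹ * Φ b` would give `φ = Φ (b * a⁻¹)`.
    obtain ⟨i, hi⟩ := hne (b * a⁻¹)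
    refine hi ?_
    have := congrFun hb i
    simp only [Pi.mul_apply, Pi.inv_apply, Φ] at this
    rw [PontryaginDual.apply_mul, PontryaginDual.apply_inv, ← this]
    simp
  obtain ⟨f, hf0, hf1, -⟩ := exists_continuous_zero_one_of_isClosed hK.isClosed hK'.isClosed hdisj
  have hint_eq : ∫ g, ((f (φ⁻¹ * Φ g) : ℝ) : ℂ) ∂μ = ∫ g, ((f (1 * Φ g) : ℝ) : ℂ) ∂μ :=
    hall ⟨fun z => (f z : ℂ), by fun_prop⟩
  have e0 (g : G) : f (1 * Φ g) = 0 := by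
    rw [one_mul]
    exact hf0 ⟨g, rfl⟩
  have e1 (g : G) : f (φ⁻¹ * Φ g) = 1 := hf1 ⟨g, rfl⟩
  -- The integrals are the total mass and 0, but Haar measure is finite and nonzero.
  simp [e0, e1, measureReal_def, ENNReal.toReal_eq_zero_iff, μ, -one_mul] at hint_eq
  exact NeZero.ne (Measure.haar : Measure G) hint_eq

theorem mainTheorem5 {G : Type*} [CommGroup G] [TopologicalSpace G] [IsTopologicalGroup G]
    [CompactSpace G] (E : Set (PontryaginDual G)) :
    ((∀ φ : E → Circle, (∀ γ : E, φ γ ∈ Set.range (γ : PontryaginDual G)) →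
        ∃ x : G, ∀ γ : E, φ γ = (γ : PontryaginDual G) x) ↔
      IsIndependentSet E) ∧
    (∀ N : ℕ, 0 < N → IsIndependentSet E →
      (∀ γ ∈ E, circleRoots N ⊆ Set.range γ) →
      IsPseudoRademacher N E) := by
  classical
  let ev (x : G) := PontryaginDual.evalHom x
  have key (hE : IsIndependentSet E) (φ : E → Circle)
      (hφ : ∀ γ : E, φ γ ∈ Set.range (γ : PontryaginDual G)) :
      ∃ x : G, ∀ γ : E, φ γ = (γ : PontryaginDual G) x := by
    refine PontryaginDual.exists_forall_eq_apply (fun γ : E => (γ : PontryaginDual G)) φ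
      fun m hm => Finset.prod_eq_one fun γ hγ => ?_
    let n : PontryaginDual G → ℤ := fun γ => if h : γ ∈ E then m ⟨γ, h⟩ else 0
    have hn (γ : E) : n γ = m γ := by simp [n]
    have h1 := hE (m.support.map (Function.Embedding.subtype _)) (by simp) n
      (by simpa [Finset.prod_map, hn, Finsupp.prod] using hm) γ (Finset.mem_map_of_mem _ hγ)
    obtain ⟨x, hx⟩ := hφ γ
    rw [hn] at h1
    change φ γ ^ m γ = 1
    rw [← hx]
    exact (map_zpow (ev x) _ _).symm.trans (congrArg (ev x) h1)
  refine ⟨⟨fun H s hs m hm γ₀ hγ₀ => ?_, key⟩, fun N _ hE hN φ hφ =>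
    key hE φ fun γ => hN γ γ.2 (hφ γ)⟩
  ext1 x
  -- The value 1 is always admissible, being taken at the identity of `G`.
  obtain ⟨y, hy⟩ := H (Function.update 1 ⟨γ₀, hs hγ₀⟩ (γ₀ x)) fun γ => by
    by_cases h : γ = ⟨γ₀, hs hγ₀⟩
    · subst h
      simp
    · rw [Function.update_of_ne h]
      exact ⟨1, map_one _⟩
  have h1 := congrArg (ev y) hm
  rw [map_prod, map_one, Finset.prod_eq_single_of_mem γ₀ hγ₀] at h1
  · have h2 := hy ⟨γ₀, hs hγ₀⟩
    rw [Function.update_self] at h2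
    rw [map_zpow] at h1
    change γ₀ y ^ m γ₀ = 1 at h1
    rw [← h2] at h1
    exact (map_zpow (ev x) γ₀ (m γ₀)).trans h1
  · intro γ hγ hne
    have h2 := hy ⟨γ, hs hγ⟩
    rw [Function.update_of_ne (by simpa using hne)] at h2
    rw [map_zpow]
    change γ y ^ m γ = 1
    rw [← h2]
    simp
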